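/- Work in the first-order language $\{\vee,\wedge\}$ of lattices, write $+$ for $\vee$ and juxtaposition for $\wedge$, and let $s\le t$ abbreviate the atomic formula $s+t=t$. A formula is \emph{positive} if it is built from atomic formulas by conjunction, disjunction and the quantifiers $\exists,\forall$ (no negation or implication). Let $\mathbf F_n$ denote the free lattice on $n$ generators. Define the positive formulas \[ \operatorname{NI}(x_1,\dots,x_4):\ \bigvee_{1\le i\le 4} \Bigl(x_i\le\sum_{j\ne i}x_j\Bigr)\ \text{ or }\ \bigvee_{1\le i\le 4}\Bigl(x_i\ge\prod_{j\ne i}x_j\Bigr), \qquad t(u):\ \forall w\ (w\le u),\qquad b(u):\ \forall w\ (w\ge u), \] and, for a finite set $X$ and intervals $I_j=[c_j,d_j]$, let $\operatorname{CI}(X,I_1,\dots,I_k)$ be the formula $\bigwedge_{x\in X}\bigvee_{j\le k}(c_j\le x\ \&\ x\le d_j)$, which says $X\subseteq\bigcup_j I_j$. For $\{x,y,z\}=\{z_1,z_2,z_3\}$ put \[ I^x=[x+yz,\ x+(x+y)(x+z)(y+z)],\quad J_x=[x(xy+xz+yz),\ x(y+z)],\quad K=[xy+xz+yz,\ (x+y)(x+z)(y+z)].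 \] Let $\pi_3$ be the sentence \begin{align*} \exists z_1\exists z_2\exists z_3\ \ & t(z_1+z_2+z_3)\ \&\ b(z_1z_2z_3)\ \&\\ &\forall x_1\forall x_2\forall x_3\forall x_4\ \Bigl[\operatorname{NI}(x_1,x_2,x_3,x_4)\ \text{ or }\ \bigvee_{i\ne j}\operatorname{CI}(\{x_1,\dots,x_4\},I^{z_i},J_{z_j},K)\\ &\hspace{9em}\text{ or }\ \bigvee_{i\le3}\operatorname{CI}(\{x_1,\dots,x_4\},[z_i,z_i],K)\Bigr]. \end{align*} Then $\pi_3$ is a positive sentence, it is logically equivalent to a positive prenex $\exists\forall$-sentence (a block of existential quantifiers, then a block of universal quantifiers, then a positive quantifier-free formula), it holds in $\mathbf F_3$, and it fails in $\mathbf F_4$. In particular, the free lattices $\mathbf F_n$ with $3\le n<\omega$ do not all satisfy the same positive sentences. -/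

import Mathlib

open FirstOrder FirstOrder.Language

namespace LatticeModel

/-! ### Free lattices -/

/-- Lattice terms over a set `α` of variables. -/
inductive LTerm (α : Type) : Type
  | var : α → LTerm α
  | sup : LTerm α → LTerm α → LTerm α
  | inf : LTerm α → LTerm α → LTerm α

/-- The least preorder on lattice terms for which `sup` is a least upper bound and `inf` is a
greatest lower bound, that is, `s ≤ t` follows from the axioms of lattices. -/
inductive LTerm.Le {α : Type} : LTerm α → LTerm α → Prop
  | refl (s : LTerm α) : LTerm.Le s s
  | trans {s t u : LTerm α} : LTerm.Le s t → LTerm.Le t u → LTerm.Le s u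
  | le_sup_left (s t : LTerm α) : LTerm.Le s (.sup s t)
  | le_sup_right (s t : LTerm α) : LTerm.Le t (.sup s t)
  | sup_le {s t u : LTerm α} : LTerm.Le s u → LTerm.Le t u → LTerm.Le (.sup s t) u
  | inf_le_left (s t : LTerm α) : LTerm.Le (.inf s t) s
  | inf_le_right (s t : LTerm α) : LTerm.Le (.inf s t) t
  | le_inf {s t u : LTerm α} : LTerm.Le s t → LTerm.Le s u → LTerm.Le s (.inf t u)

instance (α : Type) : Preorder (LTerm α) where
  le := LTerm.Le
  le_refl := LTerm.Le.refl
  le_trans _ _ _ := LTerm.Le.trans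

/-- The free lattice on the set `α`: lattice terms modulo provable equality. -/
def FreeLattice (α : Type) : Type := Antisymmetrization (LTerm α) (· ≤ ·)

namespace FreeLattice

instance (α : Type) : PartialOrder (FreeLattice α) :=
  inferInstanceAs (PartialOrder (Antisymmetrization (LTerm α) (· ≤ ·)))

/-- The class of a term. -/
def mk {α : Type} (s : LTerm α) : FreeLattice α := toAntisymmetrization (· ≤ ·) s

/-- The free generators. -/
def of {α : Type} (a : α) : FreeLattice α := mk (.var a)

theorem mk_le_mk {α : Type} {s t : LTerm α} : mk s ≤ mk t ↔ LTerm.Le s t := Iff.rfl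

theorem ind {α : Type} {p : FreeLattice α → Prop} (h : ∀ s, p (mk s)) (a : FreeLattice α) : p a :=
  Quotient.inductionOn' a h

instance (α : Type) : Lattice (FreeLattice α) where
  sup := Quotient.map₂ LTerm.sup fun _ _ h _ _ h' =>
    ⟨.sup_le (.trans h.1 (.le_sup_left _ _)) (.trans h'.1 (.le_sup_right _ _)),
     .sup_le (.trans h.2 (.le_sup_left _ _)) (.trans h'.2 (.le_sup_right _ _))⟩
  inf := Quotient.map₂ LTerm.inf fun _ _ h _ _ h' =>
    ⟨.le_inf (.trans (.inf_le_left _ _) h.1) (.trans (.inf_le_right _ _) h'.1),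
     .le_inf (.trans (.inf_le_left _ _) h.2) (.trans (.inf_le_right _ _) h'.2)⟩
  le_sup_left := ind fun _ => ind fun _ => LTerm.Le.le_sup_left _ _
  le_sup_right := ind fun _ => ind fun _ => LTerm.Le.le_sup_right _ _
  sup_le := ind fun _ => ind fun _ => ind fun _ => LTerm.Le.sup_le
  inf_le_left := ind fun _ => ind fun _ => LTerm.Le.inf_le_left _ _
  inf_le_right := ind fun _ => ind fun _ => LTerm.Le.inf_le_right _ _
  le_inf := ind fun _ => ind fun _ => ind fun _ => LTerm.Le.le_inf

theorem mk_sup {α : Type} (s t : LTerm α) : mk (.sup s t) = mk s ⊔ mk t := rfl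

theorem mk_inf {α : Type} (s t : LTerm α) : mk (.inf s t) = mk s ⊓ mk t := rfl

end FreeLattice

/-- The value of a lattice term in a lattice. -/
def LTerm.eval {α : Type} {M : Type*} [Lattice M] (f : α → M) : LTerm α → M
  | .var a => f a
  | .sup s t => s.eval f ⊔ t.eval f
  | .inf s t => s.eval f ⊓ t.eval f

theorem LTerm.eval_mono {α : Type} {M : Type*} [Lattice M] (f : α → M) {s t : LTerm α}
    (h : LTerm.Le s t) : s.eval f ≤ t.eval f := by
  induction h with
  | refl s => exact le_rfl
  | trans _ _ h₁ h₂ => exact h₁.trans h₂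
  | le_sup_left s t => exact _root_.le_sup_left
  | le_sup_right s t => exact _root_.le_sup_right
  | sup_le _ _ h₁ h₂ => exact _root_.sup_le h₁ h₂
  | inf_le_left s t => exact _root_.inf_le_left
  | inf_le_right s t => exact _root_.inf_le_right
  | le_inf _ _ h₁ h₂ => exact _root_.le_inf h₁ h₂

/-- The universal property of the free lattice. -/
theorem FreeLattice.existsUnique_lift {α : Type} {M : Type*} [Lattice M] (f : α → M) :
    ∃! g : LatticeHom (FreeLattice α) M, ∀ a, g (of a) = f a := by
  refine ⟨{ toFun := Quotient.lift (LTerm.eval f) fun s t h =>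
              le_antisymm (LTerm.eval_mono f h.1) (LTerm.eval_mono f h.2)
            map_sup' := ind fun _ => ind fun _ => rfl
            map_inf' := ind fun _ => ind fun _ => rfl }, fun a => rfl, fun g hg => ?_⟩
  ext a
  induction a using ind with
  | h s =>
    induction s with
    | var a => exact hg a
    | sup s t hs ht => rw [mk_sup, map_sup, map_sup, hs, ht]
    | inf s t hs ht => rw [mk_inf, map_inf, map_inf, hs, ht]

/-- The free lattice of finite rank `n`. -/
abbrev F (n : ℕ) : Type := FreeLattice (Fin n)

/-! ### Lattices as first-order structures -/

/-- The function symbols of lattice theory: join and meet, both binary. -/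
inductive LatticeFunc : ℕ → Type
  | sup : LatticeFunc 2
  | inf : LatticeFunc 2

/-- The language `{∨, ∧}` of lattice theory. -/
def latticeLang : Language := ⟨LatticeFunc, fun _ => Empty⟩

/-- The symbol for join. -/
def joinSym : latticeLang.Functions 2 := LatticeFunc.sup

/-- The symbol for meet. -/
def meetSym : latticeLang.Functions 2 := LatticeFunc.inf

/-- Every lattice is a structure for the language of lattices. -/
instance (M : Type*) [Lattice M] : latticeLang.Structure M where
  funMap {_} f v := match f, v with
    | .sup, v => v 0 ⊔ v 1
    | .inf, v => v 0 ⊓ v 1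
  RelMap r _ := nomatch r

/-! ### Positive formulas -/

/-- Positive quantifier-free formulas: built from atomic formulas by "and" and "or". -/
inductive IsPositiveQF {L : Language} {α : Type} : {n : ℕ} → L.BoundedFormula α n → Prop
  | equal {n : ℕ} (s t : L.Term (α ⊕ Fin n)) : IsPositiveQF (.equal s t)
  | rel {n k : ℕ} (R : L.Relations k) (ts : Fin k → L.Term (α ⊕ Fin n)) : IsPositiveQF (.rel R ts)
  | and {n : ℕ} {φ ψ : L.BoundedFormula α n} :
      IsPositiveQF φ → IsPositiveQF ψ → IsPositiveQF (φ ⊓ ψ)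
  | or {n : ℕ} {φ ψ : L.BoundedFormula α n} :
      IsPositiveQF φ → IsPositiveQF ψ → IsPositiveQF (φ ⊔ ψ)

/-- Positive formulas: built from atomic formulas by "and", "or" and both quantifiers. -/
inductive IsPositive {L : Language} {α : Type} : {n : ℕ} → L.BoundedFormula α n → Prop
  | equal {n : ℕ} (s t : L.Term (α ⊕ Fin n)) : IsPositive (.equal s t)
  | rel {n k : ℕ} (R : L.Relations k) (ts : Fin k → L.Term (α ⊕ Fin n)) : IsPositive (.rel R ts)
  | and {n : ℕ} {φ ψ : L.BoundedFormula α n} : IsPositive φ → IsPositive ψ → IsPositive (φ ⊓ ψ)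
  | or {n : ℕ} {φ ψ : L.BoundedFormula α n} : IsPositive φ → IsPositive ψ → IsPositive (φ ⊔ ψ)
  | all {n : ℕ} {φ : L.BoundedFormula α (n + 1)} : IsPositive φ → IsPositive φ.all
  | ex {n : ℕ} {φ : L.BoundedFormula α (n + 1)} : IsPositive φ → IsPositive φ.ex

/-- Positive `∀`-formulas: a block of universal quantifiers before a positive quantifier-free
formula. -/
inductive IsPositiveForall {L : Language} {α : Type} : {n : ℕ} → L.BoundedFormula α n → Prop
  | of_qf {n : ℕ} {φ : L.BoundedFormula α n} : IsPositiveQF φ → IsPositiveForall φ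
  | all {n : ℕ} {φ : L.BoundedFormula α (n + 1)} : IsPositiveForall φ → IsPositiveForall φ.all

/-- Positive `∃∀`-formulas: a block of existential quantifiers before a positive `∀`-formula. -/
inductive IsPositiveExistsForall {L : Language} {α : Type} :
    {n : ℕ} → L.BoundedFormula α n → Prop
  | of_forall {n : ℕ} {φ : L.BoundedFormula α n} : IsPositiveForall φ → IsPositiveExistsForall φ
  | ex {n : ℕ} {φ : L.BoundedFormula α (n + 1)} :
      IsPositiveExistsForall φ → IsPositiveExistsForall φ.ex

/-- The positive theory of a lattice. -/
def positiveTheory (M : Type) [Lattice M] : Set latticeLang.Sentence :=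
  {φ | IsPositive φ ∧ M ⊨ φ}

/-! ### The sentence `π₃` -/

/-- Terms whose variables are the bound variables `&0, …, &(n-1)`. -/
abbrev Tm (n : ℕ) : Type := latticeLang.Term (Empty ⊕ Fin n)

/-- Formulas whose free variables are among `&0, …, &(n-1)`. -/
abbrev Fm (n : ℕ) : Type := latticeLang.BoundedFormula Empty n

/-- Lattice terms are written with `+` for join and `*` for meet. -/
instance (n : ℕ) : Add (Tm n) := ⟨fun s t => Functions.apply₂ joinSym s t⟩

instance (n : ℕ) : Mul (Tm n) := ⟨fun s t => Functions.apply₂ meetSym s t⟩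

/-- `s ≤ t`, written in the language of lattices as `s + t = t`. -/
def leq {n : ℕ} (s t : Tm n) : Fm n := (s + t).bdEqual t

/-- Disjunction of a nonempty list of formulas. -/
def OR {n : ℕ} : List (Fm n) → Fm n
  | [] => ⊥
  | [φ] => φ
  | φ :: ψ :: l => φ ⊔ OR (ψ :: l)

/-- Conjunction of a nonempty list of formulas. -/
def AND {n : ℕ} : List (Fm n) → Fm n
  | [] => ⊤
  | [φ] => φ
  | φ :: ψ :: l => φ ⊓ AND (ψ :: l)

/-- Some `xᵢ` is below the join, or above the meet, of the three others. -/
def NI {n : ℕ} (x₁ x₂ x₃ x₄ : Tm n) : Fm n :=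
  OR [leq x₁ (x₂ + x₃ + x₄), leq x₂ (x₁ + x₃ + x₄), leq x₃ (x₁ + x₂ + x₄), leq x₄ (x₁ + x₂ + x₃),
    leq (x₂ * x₃ * x₄) x₁, leq (x₁ * x₃ * x₄) x₂, leq (x₁ * x₂ * x₄) x₃, leq (x₁ * x₂ * x₃) x₄]

/-- A term with variables `&0, …, &(n-1)`, as one with variables `&0, …, &n`. -/
def weaken {n : ℕ} (u : Tm n) : Tm (n + 1) := u.relabel (Sum.map id Fin.castSucc)

/-- `∀ w, w ≤ u`. -/
def isTop {n : ℕ} (u : Tm n) : Fm n := (leq (&(Fin.last n)) (weaken u)).all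

/-- `∀ w, w ≥ u`. -/
def isBot {n : ℕ} (u : Tm n) : Fm n := (leq (weaken u) (&(Fin.last n))).all

/-- `CI X [I₁, …, Iₖ]` says that `X ⊆ I₁ ∪ ⋯ ∪ Iₖ`, where the pair `(c, d)` stands for the
interval `[c, d]`. -/
def CI {n : ℕ} (X : List (Tm n)) (Is : List (Tm n × Tm n)) : Fm n :=
  AND (X.map fun x => OR (Is.map fun I => leq I.1 x ⊓ leq x I.2))

/-- The interval `Iˣ` with respect to `{x, y, z}`. -/
def intI {n : ℕ} (x y z : Tm n) : Tm n × Tm n :=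
  (x + y * z, x + (x + y) * (x + z) * (y + z))

/-- The interval `Jₓ` with respect to `{x, y, z}`. -/
def intJ {n : ℕ} (x y z : Tm n) : Tm n × Tm n :=
  (x * (x * y + x * z + y * z), x * (y + z))

/-- The interval `K` with respect to `{x, y, z}`. -/
def intK {n : ℕ} (x y z : Tm n) : Tm n × Tm n :=
  (x * y + x * z + y * z, (x + y) * (x + z) * (y + z))

/-- The part of `π₃` in square brackets. -/
def matrix {n : ℕ} (z₁ z₂ z₃ x₁ x₂ x₃ x₄ : Tm n) : Fm n :=
  OR [NI x₁ x₂ x₃ x₄,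
    CI [x₁, x₂, x₃, x₄] [intI z₁ z₂ z₃, intJ z₂ z₁ z₃, intK z₁ z₂ z₃],
    CI [x₁, x₂, x₃, x₄] [intI z₁ z₂ z₃, intJ z₃ z₁ z₂, intK z₁ z₂ z₃],
    CI [x₁, x₂, x₃, x₄] [intI z₂ z₁ z₃, intJ z₁ z₂ z₃, intK z₁ z₂ z₃],
    CI [x₁, x₂, x₃, x₄] [intI z₂ z₁ z₃, intJ z₃ z₁ z₂, intK z₁ z₂ z₃],
    CI [x₁, x₂, x₃, x₄] [intI z₃ z₁ z₂, intJ z₁ z₂ z₃, intK z₁ z₂ z₃],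
    CI [x₁, x₂, x₃, x₄] [intI z₃ z₁ z₂, intJ z₂ z₁ z₃, intK z₁ z₂ z₃],
    CI [x₁, x₂, x₃, x₄] [(z₁, z₁), intK z₁ z₂ z₃],
    CI [x₁, x₂, x₃, x₄] [(z₂, z₂), intK z₁ z₂ z₃],
    CI [x₁, x₂, x₃, x₄] [(z₃, z₃), intK z₁ z₂ z₃] ]

/-- The sentence `π₃`: `∃ z₁ z₂ z₃, t(z₁ + z₂ + z₃) & b(z₁ z₂ z₃) & ∀ x₁ x₂ x₃ x₄, […]`, where the
bound variables `z₁, z₂, z₃, x₁, x₂, x₃, x₄` are `&0, …, &6`. -/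
def pi3 : latticeLang.Sentence :=
  BoundedFormula.ex <| BoundedFormula.ex <| BoundedFormula.ex <|
    isTop (n := 3) (&0 + &1 + &2) ⊓ isBot (n := 3) (&0 * &1 * &2) ⊓
      (BoundedFormula.all <| BoundedFormula.all <| BoundedFormula.all <| BoundedFormula.all <|
        matrix (n := 7) (&0) (&1) (&2) (&3) (&4) (&5) (&6))

end LatticeModel

/-! The sentence holds in every lattice generated by three elements `x`, `y`, `z`. There each `w`
satisfies `x ≤ w` or `w ≤ y ⊔ z`, because the elements with this property form a sublattice
containing the generators (`Generates.le_or_le_sup`). For an independent quadruple it follows that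
at most one generator lies below entries and, dually, at most one lies above entries
(`JoinIndependent.exists_forall_not_le`). An entry with no generator below or above it lies in `K`
by the dichotomies. If `x` is the generator below entries, the entries above `x` lie in `Iˣ`; their
upper bound needs the finer dichotomy `Generates.le_or_inf_le`. Dually one obtains `J`. Running
through the positions of the two exceptional generators gives `Generates.isCovered`.

In `F 4` the four generators form an independent quadruple. They are join prime and meet prime, so a
generator lying in one of the intervals built from `x`, `y`, `z` equals `x`, `y` or `z`. A covering
would thus squeeze four distinct generators into three elements (`FreeLattice.not_isCovered_of`). -/

namespace LatticeModel

/-! ### Lattices generated by three elements -/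

section ThreeGenerated

variable {L : Type*} [Lattice L]

/-- The lattice `L` is generated by `x`, `y` and `z`. -/
def Generates (x y z : L) : Prop :=
  ∀ p : L → Prop, p x → p y → p z → (∀ a b, p a → p b → p (a ⊔ b)) →
    (∀ a b, p a → p b → p (a ⊓ b)) → ∀ w, p w

/-- The interval `Iˣ` with respect to `{x, y, z}`. -/
def upperInterval (x y z : L) : Set L :=
  Set.Icc (x ⊔ y ⊓ z) (x ⊔ (x ⊔ y) ⊓ (x ⊔ z) ⊓ (y ⊔ z))

/-- The interval `Jₓ` with respect to `{x, y, z}`. -/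
def lowerInterval (x y z : L) : Set L :=
  Set.Icc (x ⊓ (x ⊓ y ⊔ x ⊓ z ⊔ y ⊓ z)) (x ⊓ (y ⊔ z))

/-- The interval `K` with respect to `{x, y, z}`. -/
def middleInterval (x y z : L) : Set L :=
  Set.Icc (x ⊓ y ⊔ x ⊓ z ⊔ y ⊓ z) ((x ⊔ y) ⊓ (x ⊔ z) ⊓ (y ⊔ z))

/-! ### Symmetry of the intervals under permutations of the generators. -/

theorem upperMedian_swap_left (x y z : L) :
    (y ⊔ x) ⊓ (y ⊔ z) ⊓ (x ⊔ z) = (x ⊔ y) ⊓ (x ⊔ z) ⊓ (y ⊔ z) := by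
  rw [sup_comm y x, inf_right_comm]

theorem upperMedian_swap_right (x y z : L) :
    (x ⊔ z) ⊓ (x ⊔ y) ⊓ (z ⊔ y) = (x ⊔ y) ⊓ (x ⊔ z) ⊓ (y ⊔ z) := by
  rw [sup_comm z y, inf_comm (x ⊔ z)]

theorem lowerMedian_swap_left (x y z : L) :
    y ⊓ x ⊔ y ⊓ z ⊔ x ⊓ z = x ⊓ y ⊔ x ⊓ z ⊔ y ⊓ z :=
  upperMedian_swap_left (L := Lᵒᵈ) x y z

theorem lowerMedian_swap_right (x y z : L) :
    x ⊓ z ⊔ x ⊓ y ⊔ z ⊓ y = x ⊓ y ⊔ x ⊓ z ⊔ y ⊓ z :=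
  upperMedian_swap_right (L := Lᵒᵈ) x y z

theorem middleInterval_swap_left (x y z : L) : middleInterval y x z = middleInterval x y z := by
  rw [middleInterval, upperMedian_swap_left, lowerMedian_swap_left, middleInterval]

theorem middleInterval_swap_right (x y z : L) : middleInterval x z y = middleInterval x y z := by
  rw [middleInterval, upperMedian_swap_right, lowerMedian_swap_right, middleInterval]

theorem upperInterval_swap_right (x y z : L) : upperInterval x z y = upperInterval x y z := by
  rw [upperInterval, upperMedian_swap_right, inf_comm z y, upperInterval]

theorem lowerInterval_swap_right (x y z : L) : lowerInterval x z y = lowerInterval x y z := by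
  rw [lowerInterval, lowerMedian_swap_right, sup_comm z y, lowerInterval]

/-! ### Dichotomies in a lattice with three generators. -/

namespace Generates

variable {x y z : L}

theorem swap_left (h : Generates x y z) : Generates y x z :=
  fun p hx hy hz => h p hy hx hz

theorem swap_right (h : Generates x y z) : Generates x z y :=
  fun p hx hy hz => h p hx hz hy

theorem dual (h : Generates x y z) :
    Generates (OrderDual.toDual x) (OrderDual.toDual y) (OrderDual.toDual z) :=
  fun p hx hy hz hs hi => h p hx hy hz hi hs

theorem le_sup (h : Generates x y z) : ∀ w, w ≤ x ⊔ y ⊔ z :=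
  h _ (le_sup_left.trans le_sup_left) (le_sup_right.trans le_sup_left) le_sup_right
    (fun _ _ => sup_le) fun _ _ ha _ => inf_le_left.trans ha

theorem inf_le (h : Generates x y z) : ∀ w, x ⊓ y ⊓ z ≤ w :=
  h.dual.le_sup

theorem le_or_le_sup (h : Generates x y z) : ∀ w, x ≤ w ∨ w ≤ y ⊔ z := by
  refine h _ (.inl le_rfl) (.inr le_sup_left) (.inr le_sup_right) ?_ ?_
  · rintro a b (ha | ha) (hb | hb)
    · exact .inl (ha.trans le_sup_left)
    · exact .inl (ha.trans le_sup_left)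
    · exact .inl (hb.trans le_sup_right)
    · exact .inr (sup_le ha hb)
  · rintro a b (ha | ha) (hb | hb)
    · exact .inl (le_inf ha hb)
    · exact .inr (inf_le_right.trans hb)
    · exact .inr (inf_le_left.trans ha)
    · exact .inr (inf_le_left.trans ha)

theorem le_sup_of_not_le (h : Generates x y z) {w : L} (hw : ¬ x ≤ w) : w ≤ y ⊔ z :=
  (h.le_or_le_sup w).resolve_left hw

theorem inf_le_of_not_le (h : Generates x y z) {w : L} (hw : ¬ w ≤ x) : y ⊓ z ≤ w :=
  h.dual.le_sup_of_not_le hw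

/-- The element `(x ⊔ y) ⊓ (x ⊔ z)` is either below `w`, or meets `w` below
`x ⊔ (x ⊔ y) ⊓ (x ⊔ z) ⊓ (y ⊔ z)`. -/
theorem le_or_inf_le (h : Generates x y z) :
    ∀ w, (x ⊔ y) ⊓ (x ⊔ z) ≤ w ∨
      (x ⊔ y) ⊓ (x ⊔ z) ⊓ w ≤ x ⊔ (x ⊔ y) ⊓ (x ⊔ z) ⊓ (y ⊔ z) := by
  have key {w : L} (hw : w ≤ y ⊔ z) :
      (x ⊔ y) ⊓ (x ⊔ z) ⊓ w ≤ x ⊔ (x ⊔ y) ⊓ (x ⊔ z) ⊓ (y ⊔ z) :=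
    (inf_le_inf_left _ hw).trans le_sup_right
  refine h _ (.inr (inf_le_right.trans le_sup_left)) (.inr (key le_sup_left))
    (.inr (key le_sup_right)) ?_ ?_
  · intro a b ha hb
    -- If `a ⊔ b` is above `x` and another generator, the first alternative holds. If it is above
    -- `x` only, it lies below `(x ⊔ y) ⊓ (x ⊔ z)`, so meeting `a` or `b` with that element changes
    -- nothing and the induction hypotheses bound `a` and `b` themselves.
    by_cases hx : x ≤ a ⊔ b
    · by_cases hy : y ≤ a ⊔ b
      · exact .inl (inf_le_left.trans (sup_le hx hy))
      by_cases hz : z ≤ a ⊔ b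
      · exact .inl (inf_le_right.trans (sup_le hx hz))
      have hs : a ⊔ b ≤ (x ⊔ y) ⊓ (x ⊔ z) :=
        le_inf (h.swap_right.swap_left.le_sup_of_not_le hz) (h.swap_left.le_sup_of_not_le hy)
      rcases ha with ha | ha
      · exact .inl (ha.trans le_sup_left)
      rcases hb with hb | hb
      · exact .inl (hb.trans le_sup_right)
      rw [inf_eq_right.2 (le_sup_left.trans hs)] at ha
      rw [inf_eq_right.2 (le_sup_right.trans hs)] at hb
      exact .inr (inf_le_right.trans (sup_le ha hb))
    · exact .inr (key (h.le_sup_of_not_le hx))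
  · rintro a b (ha | ha) (hb | hb)
    · exact .inl (le_inf ha hb)
    · exact .inr ((inf_le_inf_left _ inf_le_right).trans hb)
    · exact .inr ((inf_le_inf_left _ inf_le_left).trans ha)
    · exact .inr ((inf_le_inf_left _ inf_le_left).trans ha)

end Generates

/-- No entry of `w` lies below the join of three entries at other positions. -/
def JoinIndependent (w : Fin 4 → L) : Prop :=
  ∀ i j k l, i ≠ j → i ≠ k → i ≠ l → ¬ w i ≤ w j ⊔ w k ⊔ w l

/-- No entry of `w` lies above the meet of three entries at other positions. -/
def MeetIndependent (w : Fin 4 → L) : Prop :=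
  ∀ i j k l, i ≠ j → i ≠ k → i ≠ l → ¬ w j ⊓ w k ⊓ w l ≤ w i

theorem MeetIndependent.dual {w : Fin 4 → L} (hw : MeetIndependent w) :
    JoinIndependent fun i => OrderDual.toDual (w i) :=
  hw

/-! ### Generators below the entries of an independent quadruple. -/

namespace JoinIndependent

variable {x y z : L} {w : Fin 4 → L}

theorem not_le (hw : JoinIndependent w) {i j : Fin 4} (hij : i ≠ j) : ¬ w i ≤ w j := by
  simpa using hw i j j j hij hij hij

/-- If `z` is also below some entry, at most three entries have the top as their join. Otherwise
every entry is below `x ⊔ y`, hence below the join of `w j` and `w k`. Either way a remaining entry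
violates independence. -/
theorem not_le_and_le (hw : JoinIndependent w) (h : Generates x y z) {j k : Fin 4} :
    ¬ (x ≤ w j ∧ y ≤ w k) := by
  rintro ⟨hx, hy⟩
  -- The positions `j`, `k`, `l` may coincide, as the definition of independence allows.
  have fourth : ∀ j k l : Fin 4, ∃ i, i ≠ j ∧ i ≠ k ∧ i ≠ l := by decide
  by_cases hz : ∃ l, z ≤ w l
  · obtain ⟨l, hz⟩ := hz
    obtain ⟨i, hij, hik, hil⟩ := fourth j k l
    exact hw i j k l hij hik hil
      ((h.le_sup _).trans (sup_le_sup (sup_le_sup hx hy) hz))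
  · push Not at hz
    obtain ⟨i, hij, hik, -⟩ := fourth j k k
    exact hw i j k k hij hik hik
      ((h.swap_right.swap_left.le_sup_of_not_le (hz i)).trans
        ((sup_le_sup hx hy).trans le_sup_left))

/-- At most one of three generators lies below an entry of a join independent quadruple. -/
theorem exists_forall_not_le (hw : JoinIndependent w) (h : Generates x y z) :
    (∀ i, ¬ y ≤ w i ∧ ¬ z ≤ w i) ∨ (∀ i, ¬ x ≤ w i ∧ ¬ z ≤ w i) ∨
      (∀ i, ¬ x ≤ w i ∧ ¬ y ≤ w i) := by
  have hxy : ∀ {i j}, ¬ (x ≤ w i ∧ y ≤ w j) := hw.not_le_and_le h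
  have hxz : ∀ {i j}, ¬ (x ≤ w i ∧ z ≤ w j) := hw.not_le_and_le h.swap_right
  have hyz : ∀ {i j}, ¬ (y ≤ w i ∧ z ≤ w j) := hw.not_le_and_le h.swap_left.swap_right
  by_cases hx : ∃ i, x ≤ w i
  · obtain ⟨i, hi⟩ := hx
    exact .inl fun j => ⟨fun hj => hxy ⟨hi, hj⟩, fun hj => hxz ⟨hi, hj⟩⟩
  push Not at hx
  by_cases hy : ∃ i, y ≤ w i
  · obtain ⟨i, hi⟩ := hy
    exact .inr (.inl fun j => ⟨hx j, fun hj => hyz ⟨hi, hj⟩⟩)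
  push Not at hy
  exact .inr (.inr fun i => ⟨hx i, hy i⟩)

/-- If `y` and `z` lie below no entry, then no entry exceeds
`x ⊔ (x ⊔ y) ⊓ (x ⊔ z) ⊓ (y ⊔ z)`. -/
theorem le_sup_median (hw : JoinIndependent w) (h : Generates x y z)
    (hU : ∀ i, ¬ y ≤ w i ∧ ¬ z ≤ w i) (i : Fin 4) :
    w i ≤ x ⊔ (x ⊔ y) ⊓ (x ⊔ z) ⊓ (y ⊔ z) := by
  have hs j : w j ≤ (x ⊔ y) ⊓ (x ⊔ z) :=
    le_inf (h.swap_right.swap_left.le_sup_of_not_le (hU j).2)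
      (h.swap_left.le_sup_of_not_le (hU j).1)
  rcases h.le_or_inf_le (w i) with hi | hi
  -- All entries are below `(x ⊔ y) ⊓ (x ⊔ z)`, so an entry above it would exceed every other one.
  · obtain ⟨j, hj⟩ : ∃ j, j ≠ i := exists_ne i
    exact absurd ((hs j).trans hi) (hw.not_le hj)
  · rwa [inf_eq_right.2 (hs i)] at hi

end JoinIndependent

/-- The entries of `w` lie in the union of the intervals `I`, `J` and `K` belonging to two different
ones of the elements `x`, `y`, `z`, or in the union of `K` and one of these elements. -/
def IsCovered (w : Fin 4 → L) (x y z : L) : Prop :=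
    (∀ i, w i ∈ upperInterval x y z ∨ w i ∈ lowerInterval y x z ∨ w i ∈ middleInterval x y z) ∨
    (∀ i, w i ∈ upperInterval x y z ∨ w i ∈ lowerInterval z x y ∨ w i ∈ middleInterval x y z) ∨
    (∀ i, w i ∈ upperInterval y x z ∨ w i ∈ lowerInterval x y z ∨ w i ∈ middleInterval x y z) ∨
    (∀ i, w i ∈ upperInterval y x z ∨ w i ∈ lowerInterval z x y ∨ w i ∈ middleInterval x y z) ∨
    (∀ i, w i ∈ upperInterval z x y ∨ w i ∈ lowerInterval x y z ∨ w i ∈ middleInterval x y z) ∨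
    (∀ i, w i ∈ upperInterval z x y ∨ w i ∈ lowerInterval y x z ∨ w i ∈ middleInterval x y z) ∨
    (∀ i, w i ∈ Set.Icc x x ∨ w i ∈ middleInterval x y z) ∨
    (∀ i, w i ∈ Set.Icc y y ∨ w i ∈ middleInterval x y z) ∨
    (∀ i, w i ∈ Set.Icc z z ∨ w i ∈ middleInterval x y z)

/-! ### Covering the entries by intervals. -/

section Cover

variable {x y z : L} {w : Fin 4 → L}

theorem mem_middleInterval (h : Generates x y z) {a : L} (hx : ¬ x ≤ a) (hy : ¬ y ≤ a)
    (hz : ¬ z ≤ a) (hx' : ¬ a ≤ x) (hy' : ¬ a ≤ y) (hz' : ¬ a ≤ z) :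
    a ∈ middleInterval x y z :=
  ⟨sup_le (sup_le (h.swap_right.swap_left.inf_le_of_not_le hz')
      (h.swap_left.inf_le_of_not_le hy')) (h.inf_le_of_not_le hx'),
    le_inf (le_inf (h.swap_right.swap_left.le_sup_of_not_le hz)
      (h.swap_left.le_sup_of_not_le hy)) (h.le_sup_of_not_le hx)⟩

/-- Only `x` can be below entries and only `y` above them; entries comparable in neither way fall
into `K`. -/
theorem mem_of_upper_ne_lower (h : Generates x y z) (hw : JoinIndependent w)
    (hw' : MeetIndependent w) (hU : ∀ i, ¬ y ≤ w i ∧ ¬ z ≤ w i)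
    (hD : ∀ i, ¬ w i ≤ x ∧ ¬ w i ≤ z) (i : Fin 4) :
    w i ∈ upperInterval x y z ∨ w i ∈ lowerInterval y x z ∨ w i ∈ middleInterval x y z := by
  by_cases hx : x ≤ w i
  · exact .inl ⟨sup_le hx (h.inf_le_of_not_le (hD i).1), hw.le_sup_median h hU i⟩
  by_cases hy : w i ≤ y
  · exact .inr (.inl ⟨hw'.dual.le_sup_median h.swap_left.dual hD i,
      le_inf hy (h.swap_left.le_sup_of_not_le (hU i).1)⟩)
  exact .inr (.inr (mem_middleInterval h hx (hU i).1 (hU i).2 (hD i).1 hy (hD i).2))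

/-- If entries occur both above and below `x`, the antichain property makes them one entry equal to
`x`, and the others fall into `K`. If one kind is missing, `y` can take over that role and the case
of two different generators applies. -/
theorem mem_of_upper_eq_lower (h : Generates x y z) (hw : JoinIndependent w)
    (hw' : MeetIndependent w) (hU : ∀ i, ¬ y ≤ w i ∧ ¬ z ≤ w i)
    (hD : ∀ i, ¬ w i ≤ y ∧ ¬ w i ≤ z) :
    (∀ i, w i ∈ upperInterval x y z ∨ w i ∈ lowerInterval y x z ∨ w i ∈ middleInterval x y z) ∨
    (∀ i, w i ∈ upperInterval y x z ∨ w i ∈ lowerInterval x y z ∨ w i ∈ middleInterval x y z) ∨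
    (∀ i, w i ∈ Set.Icc x x ∨ w i ∈ middleInterval x y z) := by
  by_cases hx : ∃ i, x ≤ w i
  · by_cases hx' : ∃ i, w i ≤ x
    · obtain ⟨i, hi⟩ := hx
      obtain ⟨j, hj⟩ := hx'
      obtain rfl : j = i := by
        by_contra hne
        exact hw.not_le hne (hj.trans hi)
      refine .inr (.inr fun k => ?_)
      by_cases hk : k = j
      · subst hk
        exact .inl ⟨hi, hj⟩
      · exact .inr (mem_middleInterval h (fun hk' => hw.not_le (Ne.symm hk) (hj.trans hk'))
          (hU k).1 (hU k).2 (fun hk' => hw.not_le hk (hk'.trans hi)) (hD k).1 (hD k).2)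
    · push Not at hx'
      exact .inl (mem_of_upper_ne_lower h hw hw' hU fun i => ⟨hx' i, (hD i).2⟩)
  · push Not at hx
    right; left
    rw [← middleInterval_swap_left]
    exact mem_of_upper_ne_lower h.swap_left hw hw' (fun i => ⟨hx i, (hU i).2⟩) hD

/-- The entries of every independent quadruple of a lattice with three generators lie in few
intervals. -/
theorem Generates.isCovered (h : Generates x y z) (hw : JoinIndependent w)
    (hw' : MeetIndependent w) : IsCovered w x y z := by
  have hU := hw.exists_forall_not_le h
  have hD := hw'.dual.exists_forall_not_le h.dual
  have hxyz := @mem_of_upper_ne_lower _ _ x y z w h hw hw'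
  have hxzy := @mem_of_upper_ne_lower _ _ x z y w h.swap_right hw hw'
  have hyxz := @mem_of_upper_ne_lower _ _ y x z w h.swap_left hw hw'
  have hyzx := @mem_of_upper_ne_lower _ _ y z x w h.swap_left.swap_right hw hw'
  have hzxy := @mem_of_upper_ne_lower _ _ z x y w h.swap_right.swap_left hw hw'
  have hzyx := @mem_of_upper_ne_lower _ _ z y x w h.swap_right.swap_left.swap_right hw hw'
  have hx := @mem_of_upper_eq_lower _ _ x y z w h hw hw'
  have hy := @mem_of_upper_eq_lower _ _ y x z w h.swap_left hw hw'
  have hz := @mem_of_upper_eq_lower _ _ z x y w h.swap_right.swap_left hw hw'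
  -- The permuted instances are rewritten to the order of generators used in `IsCovered`.
  have e₁ := middleInterval_swap_left x y z
  have e₂ := middleInterval_swap_right x y z
  have e₃ : middleInterval y z x = middleInterval x y z := by rw [middleInterval_swap_right, e₁]
  have e₄ : middleInterval z x y = middleInterval x y z := by rw [middleInterval_swap_left, e₂]
  have e₅ : middleInterval z y x = middleInterval x y z := by rw [middleInterval_swap_right, e₄]
  rw [e₂, upperInterval_swap_right x y z] at hxzy
  rw [e₁] at hyxz hy
  rw [e₃, upperInterval_swap_right y x z, lowerInterval_swap_right z x y] at hyzx
  rw [e₄, lowerInterval_swap_right x y z] at hzxy hz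
  rw [e₅, upperInterval_swap_right z x y, lowerInterval_swap_right y x z] at hzyx
  rw [upperInterval_swap_right x y z] at hz
  change (∀ i, ¬ w i ≤ y ∧ ¬ w i ≤ z) ∨ (∀ i, ¬ w i ≤ x ∧ ¬ w i ≤ z) ∨
    (∀ i, ¬ w i ≤ x ∧ ¬ w i ≤ y) at hD
  rcases hU with hU | hU | hU <;> rcases hD with hD | hD | hD
  -- The nine cases pair the generator allowed below entries with the one allowed above; the two
  -- agree in the first, fifth and ninth.
  · rcases hx hU hD with h | h | h
    · exact .inl h
    · exact .inr (.inr (.inl h))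
    · exact .inr (.inr (.inr (.inr (.inr (.inr (.inl h))))))
  · exact .inl (hxyz hU hD)
  · exact .inr (.inl (hxzy (fun i => (hU i).symm) hD))
  · exact .inr (.inr (.inl (hyxz hU hD)))
  · rcases hy hU hD with h | h | h
    · exact .inr (.inr (.inl h))
    · exact .inl h
    · exact .inr (.inr (.inr (.inr (.inr (.inr (.inr (.inl h)))))))
  · exact .inr (.inr (.inr (.inl (hyzx (fun i => (hU i).symm) (fun i => (hD i).symm)))))
  · exact .inr (.inr (.inr (.inr (.inl (hzxy hU (fun i => (hD i).symm))))))
  · exact .inr (.inr (.inr (.inr (.inr (.inl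
      (hzyx (fun i => (hU i).symm) (fun i => (hD i).symm)))))))
  · rcases hz hU hD with h | h | h
    · exact .inr (.inr (.inr (.inr (.inl h))))
    · exact .inr (.inl h)
    · exact .inr (.inr (.inr (.inr (.inr (.inr (.inr (.inr h)))))))

end Cover

end ThreeGenerated

/-! ### Generators of free lattices -/

namespace FreeLattice

variable {α : Type}

/-- Induction on the construction of an element from the generators. -/
theorem induction_of {p : FreeLattice α → Prop} (hof : ∀ a, p (of a))
    (hsup : ∀ u v, p u → p v → p (u ⊔ v)) (hinf : ∀ u v, p u → p v → p (u ⊓ v))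
    (u : FreeLattice α) : p u := by
  induction u using ind with
  | h s =>
    induction s with
    | var a => exact hof a
    | sup s t hs ht => exact hsup _ _ hs ht
    | inf s t hs ht => exact hinf _ _ hs ht

/-- A generator is below exactly the elements that a homomorphism into the two-element lattice
sends to the top. -/
theorem exists_of_le_iff (a : α) :
    ∃ g : LatticeHom (FreeLattice α) Prop, (∀ b, g (of b) ↔ b = a) ∧
      ∀ u, of a ≤ u ↔ g u := by
  obtain ⟨g, hg, -⟩ := existsUnique_lift (M := Prop) fun b : α => b = a
  have hof (b : α) : g (of b) ↔ b = a := iff_of_eq (hg b)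
  refine ⟨g, hof, fun u => ⟨fun h => OrderHomClass.mono g h ((hof a).2 rfl), ?_⟩⟩
  induction u using induction_of with
  | hof b => exact fun h => ((hof b).1 h).symm ▸ le_rfl
  | hsup u v hu hv =>
    rw [map_sup]
    exact fun h => h.elim (fun h => (hu h).trans le_sup_left) fun h => (hv h).trans le_sup_right
  | hinf u v hu hv =>
    rw [map_inf]
    exact fun h => le_inf (hu h.1) (hv h.2)

/-- A generator is above exactly the elements that a homomorphism into the two-element lattice
sends to the bottom. -/
theorem exists_le_of_iff (a : α) :
    ∃ g : LatticeHom (FreeLattice α) Prop, ∀ u, u ≤ of a ↔ ¬ g u := by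
  obtain ⟨g, hg, -⟩ := existsUnique_lift (M := Prop) fun b : α => b ≠ a
  have hof (b : α) : g (of b) ↔ b ≠ a := iff_of_eq (hg b)
  refine ⟨g, fun u => ⟨fun h hu => (hof a).1 (OrderHomClass.mono g h hu) rfl, ?_⟩⟩
  induction u using induction_of with
  | hof b =>
    intro h
    rw [hof, not_not] at h
    exact h ▸ le_rfl
  | hsup u v hu hv =>
    rw [map_sup]
    exact fun h => sup_le (hu fun h' => h (.inl h')) (hv fun h' => h (.inr h'))
  | hinf u v hu hv =>
    rw [map_inf]
    intro h
    by_cases h' : g u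
    · exact inf_le_right.trans (hv fun h'' => h ⟨h', h''⟩)
    · exact inf_le_left.trans (hu h')

theorem of_le_of {a b : α} : of a ≤ of b ↔ a = b := by
  obtain ⟨g, hg, h⟩ := exists_of_le_iff a
  rw [h, hg, eq_comm]

theorem of_injective : Function.Injective (of : α → FreeLattice α) :=
  fun _ _ h => of_le_of.1 h.le

/-- Generators are join prime, since the elements above one are the preimage of `True` under a
lattice homomorphism. -/
theorem of_le_sup {a : α} {u v : FreeLattice α} : of a ≤ u ⊔ v ↔ of a ≤ u ∨ of a ≤ v := by
  obtain ⟨g, -, h⟩ := exists_of_le_iff a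
  rw [h, h, h, map_sup]
  rfl

theorem inf_le_of {a : α} {u v : FreeLattice α} : u ⊓ v ≤ of a ↔ u ≤ of a ∨ v ≤ of a := by
  obtain ⟨g, h⟩ := exists_le_of_iff a
  rw [h, h, h, map_inf]
  exact not_and_or

end FreeLattice

/-! ### The semantics of the formulas -/

section Semantics

variable {n : ℕ}

theorem add_def (s t : Tm n) : s + t = joinSym.apply₂ s t :=
  rfl

theorem mul_def (s t : Tm n) : s * t = meetSym.apply₂ s t :=
  rfl

theorem realize_OR {M : Type*} [latticeLang.Structure M] {v : Empty → M} {xs : Fin n → M} :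
    ∀ l : List (Fm n), (OR l).Realize v xs ↔ ∃ φ ∈ l, φ.Realize v xs
  | [] => by simp [OR]
  | [φ] => by simp [OR]
  | φ :: ψ :: l => by
    rw [OR, BoundedFormula.realize_sup, realize_OR (ψ :: l)]
    simp

theorem realize_AND {M : Type*} [latticeLang.Structure M] {v : Empty → M} {xs : Fin n → M} :
    ∀ l : List (Fm n), (AND l).Realize v xs ↔ ∀ φ ∈ l, φ.Realize v xs
  | [] => by simp [AND]
  | [φ] => by simp [AND]
  | φ :: ψ :: l => by
    rw [AND, BoundedFormula.realize_inf, realize_AND (ψ :: l)]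
    simp

variable {M : Type*} [Lattice M] {v : Empty → M} {xs : Fin n → M}

theorem realize_add (s t : Tm n) :
    (s + t).realize (Sum.elim v xs) = s.realize (Sum.elim v xs) ⊔ t.realize (Sum.elim v xs) :=
  Term.realize_functions_apply₂

theorem realize_mul (s t : Tm n) :
    (s * t).realize (Sum.elim v xs) = s.realize (Sum.elim v xs) ⊓ t.realize (Sum.elim v xs) :=
  Term.realize_functions_apply₂

theorem realize_leq (s t : Tm n) :
    (leq s t).Realize v xs ↔ s.realize (Sum.elim v xs) ≤ t.realize (Sum.elim v xs) := by
  rw [leq, BoundedFormula.realize_bdEqual, realize_add, sup_eq_right]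

theorem realize_CI (X : List (Tm n)) (Is : List (Tm n × Tm n)) :
    (CI X Is).Realize v xs ↔ ∀ x ∈ X, ∃ I ∈ Is, x.realize (Sum.elim v xs) ∈
      Set.Icc (I.1.realize (Sum.elim v xs)) (I.2.realize (Sum.elim v xs)) := by
  simp only [CI, realize_AND, realize_OR, List.mem_map, forall_exists_index, and_imp,
    forall_apply_eq_imp_iff₂, exists_exists_and_eq_and, BoundedFormula.realize_inf, realize_leq,
    Set.mem_Icc]

end Semantics

theorem realize_weaken_snoc {n : ℕ} {M : Type*} [latticeLang.Structure M] (u : Tm n)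
    (v : Empty → M) (xs : Fin n → M) (a : M) :
    (weaken u).realize (Sum.elim v (Fin.snoc xs a)) = u.realize (Sum.elim v xs) := by
  rw [weaken, Term.realize_relabel]
  congr 1
  ext (i | i)
  · rfl
  · simp

/-! ### Positivity and the prenex form -/

theorem IsPositiveQF.isPositive {L : Language} {α : Type} {n : ℕ} {φ : L.BoundedFormula α n}
    (h : IsPositiveQF φ) : IsPositive φ := by
  induction h with
  | equal s t => exact .equal s t
  | rel R ts => exact .rel R ts
  | and _ _ h₁ h₂ => exact .and h₁ h₂
  | or _ _ h₁ h₂ => exact .or h₁ h₂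

theorem isPositiveQF_leq {n : ℕ} (s t : Tm n) : IsPositiveQF (leq s t) :=
  .equal _ _

theorem isPositiveQF_OR {n : ℕ} : ∀ l : List (Fm n), l ≠ [] → (∀ φ ∈ l, IsPositiveQF φ) →
    IsPositiveQF (OR l)
  | [], h, _ => absurd rfl h
  | [φ], _, h => h φ (by simp)
  | φ :: ψ :: l, _, h =>
    .or (h φ (by simp)) (isPositiveQF_OR (ψ :: l) (by simp) fun χ hχ => h χ (by simp_all))

theorem isPositiveQF_AND {n : ℕ} : ∀ l : List (Fm n), l ≠ [] → (∀ φ ∈ l, IsPositiveQF φ) →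
    IsPositiveQF (AND l)
  | [], h, _ => absurd rfl h
  | [φ], _, h => h φ (by simp)
  | φ :: ψ :: l, _, h =>
    .and (h φ (by simp)) (isPositiveQF_AND (ψ :: l) (by simp) fun χ hχ => h χ (by simp_all))

theorem isPositiveQF_CI {n : ℕ} {X : List (Tm n)} {Is : List (Tm n × Tm n)} (hX : X ≠ [])
    (hIs : Is ≠ []) : IsPositiveQF (CI X Is) := by
  refine isPositiveQF_AND _ (by simpa using hX) fun φ hφ => ?_
  obtain ⟨x, -, rfl⟩ := List.mem_map.1 hφ
  refine isPositiveQF_OR _ (by simpa using hIs) fun ψ hψ => ?_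
  obtain ⟨I, -, rfl⟩ := List.mem_map.1 hψ
  exact .and (isPositiveQF_leq _ _) (isPositiveQF_leq _ _)

theorem isPositiveQF_NI {n : ℕ} (x₁ x₂ x₃ x₄ : Tm n) : IsPositiveQF (NI x₁ x₂ x₃ x₄) := by
  refine isPositiveQF_OR _ (by simp) ?_
  simp [isPositiveQF_leq]

theorem isPositiveQF_matrix {n : ℕ} (z₁ z₂ z₃ x₁ x₂ x₃ x₄ : Tm n) :
    IsPositiveQF (matrix z₁ z₂ z₃ x₁ x₂ x₃ x₄) := by
  refine isPositiveQF_OR _ (by simp) ?_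
  simp [isPositiveQF_NI, isPositiveQF_CI]

theorem isPositive_pi3 : IsPositive pi3 :=
  .ex <| .ex <| .ex <| .and
    (.and (.all (isPositiveQF_leq _ _).isPositive) (.all (isPositiveQF_leq _ _).isPositive))
    (.all <| .all <| .all <| .all (isPositiveQF_matrix _ _ _ _ _ _ _).isPositive)

/-- A prenex form of `π₃`. -/
def pi3Prenex : latticeLang.Sentence :=
  BoundedFormula.ex <| BoundedFormula.ex <| BoundedFormula.ex <|
    BoundedFormula.all <| BoundedFormula.all <| BoundedFormula.all <| BoundedFormula.all <|
      leq (n := 7) (&3) (&0 + &1 + &2) ⊓ leq (n := 7) (&0 * &1 * &2) (&3) ⊓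
        matrix (n := 7) (&0) (&1) (&2) (&3) (&4) (&5) (&6)

theorem isPositiveExistsForall_pi3Prenex : IsPositiveExistsForall pi3Prenex :=
  .ex <| .ex <| .ex <| .of_forall <| .all <| .all <| .all <| .all <| .of_qf <|
    .and (.and (isPositiveQF_leq _ _) (isPositiveQF_leq _ _)) (isPositiveQF_matrix _ _ _ _ _ _ _)

/-- The equivalence ranges over all structures of the language, not only lattices, so `leq` is
treated as a bare equation. One universal variable serves the top and bottom conditions as well as
`x₁`. -/
theorem pi3_iff_pi3Prenex : Theory.Iff ∅ pi3 pi3Prenex := by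
  intro M v xs
  rw [BoundedFormula.realize_iff]
  simp only [pi3, pi3Prenex, BoundedFormula.realize_ex, BoundedFormula.realize_all,
    BoundedFormula.realize_inf, isTop, isBot, leq, BoundedFormula.realize_bdEqual, add_def, mul_def,
    Term.realize_functions_apply₂, realize_weaken_snoc, Function.comp_apply, Term.realize_var,
    Sum.elim_inr]
  exact exists_congr fun z₁ => exists_congr fun z₂ => exists_congr fun z₃ =>
    ⟨fun h x₁ x₂ x₃ x₄ => ⟨⟨h.1.1 x₁, h.1.2 x₁⟩, h.2 x₁ x₂ x₃ x₄⟩,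
      fun h => ⟨⟨fun w => (h w w w w).1.1, fun w => (h w w w w).1.2⟩,
        fun x₁ x₂ x₃ x₄ => (h x₁ x₂ x₃ x₄).2⟩⟩

/-! ### The truth of `π₃` in the free lattices -/

section Matrix

variable {M : Type*} [Lattice M] {n : ℕ} {v : Empty → M} {xs : Fin n → M}

theorem joinIndependent_cons {a b c d : M} :
    JoinIndependent ![a, b, c, d] ↔
      ¬ (a ≤ b ⊔ c ⊔ d ∨ b ≤ a ⊔ c ⊔ d ∨ c ≤ a ⊔ b ⊔ d ∨ d ≤ a ⊔ b ⊔ c) := by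
  refine ⟨?_, fun h i j k l hij hik hil hle => h ?_⟩
  · rintro h (h' | h' | h' | h')
    · exact h 0 1 2 3 (by decide) (by decide) (by decide) h'
    · exact h 1 0 2 3 (by decide) (by decide) (by decide) h'
    · exact h 2 0 1 3 (by decide) (by decide) (by decide) h'
    · exact h 3 0 1 2 (by decide) (by decide) (by decide) h'
  -- Since `j`, `k`, `l` may repeat, their join is compared with the join of all three other
  -- entries.
  · have key (u : M) (hu : ∀ j, i ≠ j → ![a, b, c, d] j ≤ u) : ![a, b, c, d] i ≤ u :=
      hle.trans (sup_le (sup_le (hu j hij) (hu k hik)) (hu l hil))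
    fin_cases i
    · exact .inl (key _ (by simp [Fin.forall_fin_succ, le_sup_of_le_left]))
    · exact .inr (.inl (key _ (by simp [Fin.forall_fin_succ, le_sup_of_le_left])))
    · exact .inr (.inr (.inl (key _ (by simp [Fin.forall_fin_succ, le_sup_of_le_left]))))
    · exact .inr (.inr (.inr (key _ (by simp [Fin.forall_fin_succ, le_sup_of_le_left]))))

theorem meetIndependent_cons {a b c d : M} :
    MeetIndependent ![a, b, c, d] ↔
      ¬ (b ⊓ c ⊓ d ≤ a ∨ a ⊓ c ⊓ d ≤ b ∨ a ⊓ b ⊓ d ≤ c ∨ a ⊓ b ⊓ c ≤ d) :=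
  joinIndependent_cons (M := Mᵒᵈ)

/-- The values enter through equations, so that for the variables of `pi3` each can be proved by
`rfl`. -/
theorem realize_NI (x₁ x₂ x₃ x₄ : Tm n) {a b c d : M} (h₁ : x₁.realize (Sum.elim v xs) = a)
    (h₂ : x₂.realize (Sum.elim v xs) = b) (h₃ : x₃.realize (Sum.elim v xs) = c)
    (h₄ : x₄.realize (Sum.elim v xs) = d) :
    (NI x₁ x₂ x₃ x₄).Realize v xs ↔
      ¬ (JoinIndependent ![a, b, c, d] ∧ MeetIndependent ![a, b, c, d]) := by
  rw [joinIndependent_cons, meetIndependent_cons, ← not_or, not_not]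
  simp only [NI, realize_OR, realize_leq, realize_add, realize_mul, List.mem_cons,
    List.not_mem_nil, or_false, exists_eq_or_imp, exists_eq_left, h₁, h₂, h₃, h₄, or_assoc]

theorem realize_CI_four (x₁ x₂ x₃ x₄ : Tm n) {a b c d : M}
    (h₁ : x₁.realize (Sum.elim v xs) = a)
    (h₂ : x₂.realize (Sum.elim v xs) = b) (h₃ : x₃.realize (Sum.elim v xs) = c)
    (h₄ : x₄.realize (Sum.elim v xs) = d) (Is : List (Tm n × Tm n)) :
    (CI [x₁, x₂, x₃, x₄] Is).Realize v xs ↔ ∀ i, ∃ I ∈ Is, ![a, b, c, d] i ∈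
      Set.Icc (I.1.realize (Sum.elim v xs)) (I.2.realize (Sum.elim v xs)) := by
  rw [realize_CI]
  simp [Fin.forall_fin_succ, h₁, h₂, h₃, h₄]

theorem realize_matrix (z₁ z₂ z₃ x₁ x₂ x₃ x₄ : Tm n) {x y z a b c d : M}
    (hx : z₁.realize (Sum.elim v xs) = x) (hy : z₂.realize (Sum.elim v xs) = y)
    (hz : z₃.realize (Sum.elim v xs) = z) (h₁ : x₁.realize (Sum.elim v xs) = a)
    (h₂ : x₂.realize (Sum.elim v xs) = b) (h₃ : x₃.realize (Sum.elim v xs) = c)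
    (h₄ : x₄.realize (Sum.elim v xs) = d) :
    (matrix z₁ z₂ z₃ x₁ x₂ x₃ x₄).Realize v xs ↔
      (JoinIndependent ![a, b, c, d] → MeetIndependent ![a, b, c, d] →
        IsCovered ![a, b, c, d] x y z) := by
  rw [← and_imp, imp_iff_not_or, IsCovered]
  simp only [matrix, realize_OR, List.mem_cons, List.not_mem_nil, or_false, exists_eq_or_imp,
    exists_eq_left, realize_NI x₁ x₂ x₃ x₄ h₁ h₂ h₃ h₄, realize_CI_four x₁ x₂ x₃ x₄ h₁ h₂ h₃ h₄,
    intI, intJ, intK, realize_add, realize_mul, hx, hy, hz, upperInterval, lowerInterval,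
    middleInterval]

end Matrix

/-- The meaning of `π₃` in a lattice. -/
theorem realize_pi3 {M : Type*} [Lattice M] :
    M ⊨ pi3 ↔ ∃ x y z : M, (∀ w, w ≤ x ⊔ y ⊔ z) ∧ (∀ w, x ⊓ y ⊓ z ≤ w) ∧
      ∀ w : Fin 4 → M, JoinIndependent w → MeetIndependent w → IsCovered w x y z := by
  rw [Sentence.Realize, Formula.Realize, pi3]
  simp only [BoundedFormula.realize_ex, BoundedFormula.realize_all,
    BoundedFormula.realize_inf, isTop, isBot, realize_leq, realize_weaken_snoc]
  simp only [realize_add, realize_mul, Function.comp_apply, Term.realize_var, Sum.elim_inr]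
  refine exists_congr fun x => exists_congr fun y => exists_congr fun z => ?_
  rw [and_assoc]
  refine and_congr (forall_congr' fun w => Iff.rfl) (and_congr (forall_congr' fun w => Iff.rfl) ?_)
  refine Iff.trans (forall_congr' fun a => forall_congr' fun b => forall_congr' fun c =>
    forall_congr' fun d => realize_matrix (x := x) (y := y) (z := z) (a := a) (b := b) (c := c)
      (d := d) _ _ _ _ _ _ _ rfl rfl rfl rfl rfl rfl rfl) ⟨fun h w => ?_, fun h a b c d => h _⟩
  have hw : ![w 0, w 1, w 2, w 3] = w := by
    ext i
    fin_cases i <;> rfl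
  exact hw ▸ h (w 0) (w 1) (w 2) (w 3)

/-- Every lattice with three generators satisfies `π₃`. -/
theorem Generates.realize_pi3 {M : Type*} [Lattice M] {x y z : M} (h : Generates x y z) :
    M ⊨ pi3 :=
  LatticeModel.realize_pi3.2 ⟨x, y, z, h.le_sup, h.inf_le, fun _ => h.isCovered⟩

open FreeLattice in
theorem generates_of : Generates (of 0 : F 3) (of 1) (of 2) := by
  intro p h₀ h₁ h₂ hsup hinf
  refine induction_of (fun a => ?_) hsup hinf
  fin_cases a
  exacts [h₀, h₁, h₂]

/-! ### Failure in the free lattice on four generators. -/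

namespace FreeLattice

variable {α : Type} {a : α} {x y z : FreeLattice α}

/-- By primeness the lower end puts `x` and one of `y`, `z` below the generator; the upper end puts
`x`, or two of the three elements, above it. Some element is then on both sides. -/
theorem of_mem_upperInterval (h : of a ∈ upperInterval x y z) :
    of a = x ∨ of a = y ∨ of a = z := by
  simp only [upperInterval, Set.mem_Icc, sup_le_iff, le_inf_iff, of_le_sup, inf_le_of] at h
  simp only [le_antisymm_iff]
  tauto

theorem of_mem_lowerInterval (h : of a ∈ lowerInterval x y z) :
    of a = x ∨ of a = y ∨ of a = z := by
  simp only [lowerInterval, Set.mem_Icc, sup_le_iff, le_inf_iff, of_le_sup, inf_le_of] at h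
  simp only [le_antisymm_iff]
  tauto

/-- By primeness, two of `x`, `y`, `z` are below the generator and two are above it, so one is both.
-/
theorem of_mem_middleInterval (h : of a ∈ middleInterval x y z) :
    of a = x ∨ of a = y ∨ of a = z := by
  simp only [middleInterval, Set.mem_Icc, sup_le_iff, le_inf_iff, of_le_sup, inf_le_of] at h
  simp only [le_antisymm_iff]
  tauto

theorem joinIndependent_of : JoinIndependent (of : Fin 4 → F 4) := by
  intro i j k l hij hik hil
  simp only [of_le_sup, of_le_of]
  tauto

theorem meetIndependent_of : MeetIndependent (of : Fin 4 → F 4) := by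
  intro i j k l hij hik hil
  simp only [inf_le_of, of_le_of, @eq_comm _ _ i]
  tauto

theorem not_isCovered_of (x y z : F 4) : ¬ IsCovered of x y z := by
  intro h
  have hmem : ∀ i : Fin 4, ∃ j, of i = ![x, y, z] j := by
    intro i
    have hi : of i = x ∨ of i = y ∨ of i = z := by
      rcases h with h | h | h | h | h | h | h | h | h
      any_goals
        rcases h i with h | h | h
        · have := of_mem_upperInterval h
          tauto
        · have := of_mem_lowerInterval h
          tauto
        · exact of_mem_middleInterval h
      -- What remains are the three coverings by a one-point interval and `K`.
      all_goals
        rcases h i with h | h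
        · rw [Set.Icc_self, Set.mem_singleton_iff] at h
          tauto
        · exact of_mem_middleInterval h
    rcases hi with hi | hi | hi
    exacts [⟨0, hi⟩, ⟨1, hi⟩, ⟨2, hi⟩]
  choose f hf using hmem
  have hinj : Function.Injective f := fun i j hij => of_injective (by rw [hf, hf, hij])
  simpa using Fintype.card_le_of_injective f hinj

end FreeLattice

theorem not_realize_pi3_four : ¬ (F 4 ⊨ pi3) := by
  rw [realize_pi3]
  rintro ⟨x, y, z, -, -, h⟩
  exact FreeLattice.not_isCovered_of x y z
    (h _ FreeLattice.joinIndependent_of FreeLattice.meetIndependent_of)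

end LatticeModel

theorem mainTheorem2 :
    LatticeModel.IsPositive LatticeModel.pi3 ∧
    (∃ ψ : LatticeModel.latticeLang.Sentence,
      LatticeModel.IsPositiveExistsForall ψ ∧
        FirstOrder.Language.Theory.Iff ∅ LatticeModel.pi3 ψ) ∧
    LatticeModel.F 3 ⊨ LatticeModel.pi3 ∧
    ¬ (LatticeModel.F 4 ⊨ LatticeModel.pi3) ∧
    ¬ (∀ m n : ℕ, 3 ≤ m → 3 ≤ n →
      LatticeModel.positiveTheory (LatticeModel.F m) =
        LatticeModel.positiveTheory (LatticeModel.F n)) := by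
  refine ⟨LatticeModel.isPositive_pi3,
    ⟨_, LatticeModel.isPositiveExistsForall_pi3Prenex, LatticeModel.pi3_iff_pi3Prenex⟩,
    LatticeModel.generates_of.realize_pi3, LatticeModel.not_realize_pi3_four, fun h => ?_⟩
  have h₃ : LatticeModel.pi3 ∈ LatticeModel.positiveTheory (LatticeModel.F 3) :=
    ⟨LatticeModel.isPositive_pi3, LatticeModel.generates_of.realize_pi3⟩
  rw [h 3 4 le_rfl (by norm_num)] at h₃
  exact LatticeModel.not_realize_pi3_four h₃.2
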